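/- Let $\{0,1\}^{\mathbb N}$ carry the product topology, and let $LPO:\{0,1\}^{\mathbb N}\to\{0,1\}^{\mathbb N}$ be given by $LPO(0^{\mathbb N})=0^{\mathbb N}$ and $LPO(w)=10^{\mathbb N}$ for $w\neq 0^{\mathbb N}$. **Machines.** An Oracle-Type-2-Machine $M$ is a labelled directed graph whose unique source is its unique vertex labelled $s$. A vertex labelled $s$, $l_i$, $r_i$ ($i\in\{0,1,2\}$) or $w_i^b$ ($i\in\{1,2,3\}$, $b\in\{0,1\}$) has one successor $S$, a vertex labelled $t_i$ ($i\in\{0,1,2\}$) or $?$ has two ordered successors $S_0,S_1$, and a vertex labelled $a$ or $r$ has none. A configuration consists of a vertex $q$, contents $w_0,\dots,w_3\in\{0,1\}^{\mathbb N}$ of an input tape, two working tapes and an output tape, and head positions $n_0,\dots,n_3\in\mathbb N$. One step $\to_0$ moves from $q$ to $S(q)$ if $q$ is labelled $s$; to $S_{w_i[n_i]}(q)$ if it is labelled $t_i$; to $S(q)$, increasing $n_i$ by one, resp. decreasing it by one (possible only if $n_i>0$), if it is labelled $r_i$, resp. $l_i$; to $S(q)$, writing $b$ at the position $n_i$ of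 the tape $i$ and increasing $n_i$ by one, if it is labelled $w_i^b$. There is no step $\to_0$ from a vertex labelled $a$, $r$ or $?$. For a transition relation $\to$ with reflexive transitive closure $\Rightarrow$, a configuration $c$ *yields* $w\in\{0,1\}^{\mathbb N}$ if either $c\Rightarrow c'$ for some $c'$ at a vertex labelled $a$ with $w$ on its output tape, or for each $m\ge n_3(c)$ there is $c^m$ with $c\Rightarrow c^m$ and output head position $m$ such that the contents of the output tapes of the $c^m$ converge to $w$ as $m\to\infty$. With the oracle $LPO$ and query depth $1$, the relation $\to_1$ consists of $\to_0$ and of the *oracle calls*: from $(q,w_0,n_0,w_1,n_1,w_2,n_2,w_3,n_3)$ with $q$ labelled $?$ to $(S_0(q),w_0,n_0,w_1,n_1,LPO(x),0,w_3,n_3)$, whenever $(S_1(q),w_0,n_0,w_1,n_1,w_2,n_2,0^{\mathbb N},0)$ yields $x$ with respect to $\to_0$. On the input $x$ the machine starts at the vertex labelled $s$, with $x$ on the input tape, $0^{\mathbb N}$ on the other tapes, and all heads at position $0$. It *computes* a partial function $f:\subseteq\{0,1\}^{\mathbb N}\to\{0,1\}^{\mathbb N}$ if, for each $x\in\operatorname{dom}(f)$,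 the sequence $f(x)$ is the only one yielded from the start configuration on $x$ with respect to $\to_1$. It *makes at most $n$ calls* if, for each $x\in\operatorname{dom}(f)$, no finite sequence of transitions $\to_1$ from the start configuration on $x$ contains more than $n$ oracle calls. **Level.** For $f:\subseteq\{0,1\}^{\mathbb N}\to\{0,1\}^{\mathbb N}$ let $\mathcal L_0(f)=\operatorname{dom}(f)$, let $\mathcal L_{\alpha+1}(f)$ be the closure, relative to $\operatorname{dom}(f)$, of the set of all $x\in\mathcal L_\alpha(f)$ at which the restriction $f|_{\mathcal L_\alpha(f)}$ is discontinuous, and let $\mathcal L_\lambda(f)=\bigcap_{\alpha<\lambda}\mathcal L_\alpha(f)$ for limit ordinals $\lambda$. The level of discontinuity $\operatorname{Lev}(f)$ is the least ordinal $\alpha$ with $\mathcal L_\alpha(f)=\emptyset$, and $\infty$ if there is none. **Theorem.** Let $n\in\mathbb N$. If $f$ is computed, with query depth $1$, by an Oracle-Type-2-Machine making at most $n$ calls to an oracle for $LPO$, then $\operatorname{Lev}(f)\le 2^n$. -/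

import Mathlib

open Set Filter Topology

noncomputable section

namespace OracleTypeTwo

/-- Infinite binary sequences, with the product topology (Cantor space); `false` is the
symbol `0` and `true` is the symbol `1`. -/
abbrev Seq : Type := ℕ → Bool

/-- The sequence `0^ℕ`. -/
def zeroSeq : Seq := fun _ => false

/-- The label of a vertex together with its (ordered) outgoing edges. The four tapes are
numbered `0` (input), `1`, `2` (working tapes) and `3` (output).

* `start q`: label `s`;
* `test i q₀ q₁`: label `t_i`, for `i ∈ {0, 1, 2}`, first successor `q₀`, second `q₁`;
* `left i q`, `right i q`: labels `l_i`, `r_i`, for `i ∈ {0, 1, 2}`;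
* `write i b q`: label `w_{i+1}^b`, so that the tapes `1`, `2`, `3` can be written to;
* `accept`, `reject`: the sinks `a`, `r`;
* `query q₀ q₁`: label `?`, first successor `q₀`, second successor `q₁`. -/
inductive Instr (V : Type*) : Type _
  | start (q : V)
  | test (i : Fin 3) (q₀ q₁ : V)
  | left (i : Fin 3) (q : V)
  | right (i : Fin 3) (q : V)
  | write (i : Fin 3) (b : Bool) (q : V)
  | accept
  | reject
  | query (q₀ q₁ : V)

/-- The set of successors of a vertex carrying the given instruction. -/
def Instr.succs {V : Type*} : Instr V → Set V
  | .start q => {q}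
  | .test _ q₀ q₁ => {q₀, q₁}
  | .left _ q => {q}
  | .right _ q => {q}
  | .write _ _ q => {q}
  | .accept => ∅
  | .reject => ∅
  | .query q₀ q₁ => {q₀, q₁}

/-- The vertex is labelled `s`. -/
def Instr.IsStart {V : Type*} (I : Instr V) : Prop := ∃ q, I = .start q

/-- The vertex is labelled `?`. -/
def Instr.IsQuery {V : Type*} (I : Instr V) : Prop := ∃ q₀ q₁, I = .query q₀ q₁

/-- An Oracle-Type-2-Machine with vertex set `V`: a labelled directed graph whose unique source
is its unique vertex labelled `s`. No finiteness of `V` is demanded. -/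
structure Machine (V : Type*) where
  instr : V → Instr V
  init : V
  isStart_iff : ∀ v, (instr v).IsStart ↔ v = init
  source_iff : ∀ v, (∀ u, v ∉ (instr u).succs) ↔ v = init

/-- A configuration: the current vertex, the contents `w_i` of the four tapes and the
positions `n_i` of the four heads. -/
structure Config (V : Type*) where
  q : V
  tape : Fin 4 → Seq
  pos : Fin 4 → ℕ

variable {V : Type*}

/-- The initial configuration of `M` on the input `x`. -/
def Machine.initConfig (M : Machine V) (x : Seq) : Config V where
  q := M.init
  tape := Function.update (fun _ => zeroSeq) 0 x
  pos := fun _ => 0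

/-- Single step transitions of an ordinary Type-2-Machine. Vertices labelled `a`, `r` or `?`
allow no such step, and a head cannot be moved to the left of the position `0`. -/
inductive Machine.Step (M : Machine V) : Config V → Config V → Prop
  | start (c : Config V) (q : V) (h : M.instr c.q = .start q) :
      Machine.Step M c { c with q := q }
  | test (c : Config V) (i : Fin 3) (q₀ q₁ : V) (h : M.instr c.q = .test i q₀ q₁) :
      Machine.Step M c
        { c with q := bif c.tape i.castSucc (c.pos i.castSucc) then q₁ else q₀ }
  | right (c : Config V) (i : Fin 3) (q : V) (h : M.instr c.q = .right i q) :
      Machine.Step M c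
        { c with q := q, pos := Function.update c.pos i.castSucc (c.pos i.castSucc + 1) }
  | left (c : Config V) (i : Fin 3) (q : V) (h : M.instr c.q = .left i q) (n : ℕ)
      (hn : c.pos i.castSucc = n + 1) :
      Machine.Step M c { c with q := q, pos := Function.update c.pos i.castSucc n }
  | write (c : Config V) (i : Fin 3) (b : Bool) (q : V) (h : M.instr c.q = .write i b q) :
      Machine.Step M c
        { q := q
          tape := Function.update c.tape i.succ
            (Function.update (c.tape i.succ) (c.pos i.succ) b)
          pos := Function.update c.pos i.succ (c.pos i.succ + 1) }

/-- The output relation derived from a relation `R` of arbitrary transitions: `w` is an output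
from the configuration `c`, either by reaching an accepting vertex with `w` on the output tape,
or by reaching configurations with all head positions `m ≥ n₃` on the output tape, the contents
of the output tape converging to `w`. -/
def Machine.Yields (M : Machine V) (R : Config V → Config V → Prop) (c : Config V) (w : Seq) :
    Prop :=
  (∃ c', R c c' ∧ M.instr c'.q = .accept ∧ c'.tape 3 = w) ∨
  (∃ d : ℕ → Config V, (∀ m, c.pos 3 ≤ m → R c (d m) ∧ (d m).pos 3 = m) ∧
    Tendsto (fun m => (d m).tape 3) atTop (𝓝 w))

/-- The single step transitions `→_n` with query depth `n` and the multi-valued partial oracle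
`O`. The vertex `?` spawns a copy of the machine, with erased output tape, at the second
successor; an answer of the oracle to its output replaces the second working tape, and the
computation proceeds at the first successor. -/
def Machine.OracleStep (M : Machine V) (O : Seq → Set Seq) :
    ℕ → Config V → Config V → Prop
  | 0 => M.Step
  | n + 1 => fun c c' =>
      Machine.OracleStep M O n c c' ∨
      ∃ q₀ q₁ x y, M.instr c.q = .query q₀ q₁ ∧
        M.Yields (Relation.ReflTransGen (Machine.OracleStep M O n))
          { q := q₁
            tape := Function.update c.tape 3 zeroSeq
            pos := Function.update c.pos 3 0 } x ∧
        y ∈ O x ∧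
        c' = { q := q₀
               tape := Function.update c.tape 2 y
               pos := Function.update c.pos 2 0 }

/-- The multi-valued function `F_n` computed by `M` with oracle `O` and query depth `n`. -/
def Machine.multiFun (M : Machine V) (O : Seq → Set Seq) (n : ℕ) (x : Seq) : Set Seq :=
  {y | M.Yields (Relation.ReflTransGen (M.OracleStep O n)) (M.initConfig x) y}

/-- `M.Run O d c k c'`: with query depth `d`, there is a finite sequence of transitions from `c`
to `c'`, exactly `k` of which are oracle calls (that is, start at a vertex labelled `?`). -/
inductive Machine.Run (M : Machine V) (O : Seq → Set Seq) (d : ℕ) :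
    Config V → ℕ → Config V → Prop
  | refl (c : Config V) : Machine.Run M O d c 0 c
  | step {c c' c'' : Config V} {k : ℕ} (h : Machine.Run M O d c k c')
      (hs : M.OracleStep O d c' c'') (hq : ¬ (M.instr c'.q).IsQuery) :
      Machine.Run M O d c k c''
  | call {c c' c'' : Config V} {k : ℕ} (h : Machine.Run M O d c k c')
      (hs : M.OracleStep O d c' c'') (hq : (M.instr c'.q).IsQuery) :
      Machine.Run M O d c (k + 1) c''

/-- With query depth `1` and oracle `O`, the machine `M` computes the partial function `f` with
domain `D`, making at most `n` oracle calls on each input from `D`. -/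
def Machine.ComputesWithCalls (M : Machine V) (O : Seq → Set Seq) (n : ℕ) {D : Set Seq}
    (f : D → Seq) : Prop :=
  ∀ x : D, M.multiFun O 1 x = {f x} ∧ ∀ k c, M.Run O 1 (M.initConfig x) k c → k ≤ n

open Classical in
/-- `LPO (0^ℕ) = 0^ℕ`, and `LPO w = 10^ℕ` for `w ≠ 0^ℕ`. -/
def LPO (w : Seq) : Seq := if w = zeroSeq then zeroSeq else Function.update zeroSeq 0 true

/-- `LPO` as a (single-valued, total) oracle. -/
def LPOOracle (w : Seq) : Set Seq := {LPO w}

/-- The sets `L_α(f)`: `L_0(f)` is the whole domain, `L_{α+1}(f)` is the closure (in the domain)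
of the set of the points of `L_α(f)` at which the restriction of `f` to `L_α(f)` is
discontinuous, and at limit stages the intersection is taken. -/
def levelSet {X Y : Type*} [TopologicalSpace X] [TopologicalSpace Y] (f : X → Y)
    (α : Ordinal.{0}) : Set X :=
  Ordinal.limitRecOn (motive := fun _ => Set X) α univ
    (fun _ L => closure {x ∈ L | ¬ ContinuousWithinAt f L x})
    (fun β _ L => ⋂ (γ : Ordinal.{0}) (h : γ < β), L γ h)

open Classical in
/-- The level of discontinuity `Lev(f)`: the least ordinal `α` with `L_α(f) = ∅`, and `⊤` if
there is none. -/
def Lev {X Y : Type} [TopologicalSpace X] [TopologicalSpace Y] (f : X → Y) :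
    WithTop Ordinal.{0} :=
  if ∃ α, levelSet f α = ∅ then ((sInf {α | levelSet f α = ∅} : Ordinal.{0}) : WithTop Ordinal.{0})
  else ⊤

end OracleTypeTwo

end

namespace OracleTypeTwo

/-! ### Finite levels of discontinuity -/

section Level

variable {X Y : Type*} [TopologicalSpace X] [TopologicalSpace Y] {f : X → Y}

/-! Without an oracle call each output symbol is fixed after finitely many ordinary steps, which
inspect finitely many cells; hence `f` is continuous there. For the general case, induct on the
number of calls, for a family of configurations depending continuously on `x` in a closed set `S`,
near an open set `U` (`iterate_derivSet_inter_eq_empty`).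

Suppose a query is reached after `t` ordinary steps. Nearby points of `S` reach the same query
vertex after `t` steps, and the argument `g x` passed to the oracle depends continuously on `x`. So
`g x ≠ 0^ℕ` is a relatively open condition, under which the answer is constant; by induction `2 ^ n`
derivations clear that part. On the closed remainder `g x = 0^ℕ`, the answer is again constant, and
`2 ^ n` more derivations suffice (`iterate_derivSet_inter_eq_empty_of_query`). Points without a
query are points of continuity and need no neighbourhood of this kind
(`iterate_derivSet_inter_eq_empty_of_local`). -/

/-- The closure of the set of discontinuities of the restriction of `f` to `S`. -/
def derivSet (f : X → Y) (S : Set X) : Set X :=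
  closure {x ∈ S | ¬ ContinuousWithinAt f S x}

lemma derivSet_subset {S : Set X} (hS : IsClosed S) : derivSet f S ⊆ S :=
  closure_minimal (fun _ hx => hx.1) hS

lemma isClosed_iterate_derivSet {S : Set X} (hS : IsClosed S) (k : ℕ) :
    IsClosed ((derivSet f)^[k] S) := by
  cases k with
  | zero => exact hS
  | succ k => rw [Function.iterate_succ_apply']; exact isClosed_closure

lemma iterate_derivSet_subset {S : Set X} (hS : IsClosed S) (k : ℕ) :
    (derivSet f)^[k] S ⊆ S := by
  induction k with
  | zero => exact subset_rfl
  | succ k ih =>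
    rw [Function.iterate_succ_apply']
    exact (derivSet_subset (isClosed_iterate_derivSet hS k)).trans ih

lemma levelSet_natCast (f : X → Y) (k : ℕ) :
    levelSet f (k : Ordinal.{0}) = (derivSet f)^[k] univ := by
  induction k with
  | zero => simp [levelSet, Ordinal.limitRecOn_zero]
  | succ k ih =>
    rw [Function.iterate_succ_apply', ← ih, Nat.cast_succ]
    simp only [levelSet, Ordinal.limitRecOn_add_one, derivSet]

lemma Lev_le_of_levelSet_eq_empty {X Y : Type} [TopologicalSpace X] [TopologicalSpace Y]
    {f : X → Y} {α : Ordinal.{0}} (h : levelSet f α = ∅) : Lev f ≤ (α : WithTop Ordinal.{0}) := by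
  rw [Lev, if_pos ⟨α, h⟩]
  exact WithTop.coe_le_coe.2 (csInf_le' h)

end Level

variable {V : Type*} {M : Machine V}

/-! ### The ordinary transitions as a function -/

/-- The successor of a configuration for `→₀`; the configuration itself if there is none. -/
def Machine.next (M : Machine V) (c : Config V) : Config V :=
  match M.instr c.q with
  | .start q => { c with q := q }
  | .test i q₀ q₁ => { c with q := bif c.tape i.castSucc (c.pos i.castSucc) then q₁ else q₀ }
  | .right i q =>
      { c with q := q, pos := Function.update c.pos i.castSucc (c.pos i.castSucc + 1) }
  | .left i q =>
      if c.pos i.castSucc = 0 then c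
      else { c with q := q, pos := Function.update c.pos i.castSucc (c.pos i.castSucc - 1) }
  | .write i b q =>
      { q := q
        tape := Function.update c.tape i.succ
          (Function.update (c.tape i.succ) (c.pos i.succ) b)
        pos := Function.update c.pos i.succ (c.pos i.succ + 1) }
  | .accept => c
  | .reject => c
  | .query _ _ => c

lemma Machine.Step.next_eq {c c' : Config V} (h : M.Step c c') : M.next c = c' := by
  cases h <;> simp_all [Machine.next]

lemma Machine.next_eq_self_or_step (M : Machine V) (c : Config V) :
    M.next c = c ∨ (M.Step c (M.next c) ∧ ¬ (M.instr c.q).IsQuery) := by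
  unfold Machine.next
  split
  next q h => exact .inr ⟨.start c q h, by simp [h, Instr.IsQuery]⟩
  next i q₀ q₁ h => exact .inr ⟨.test c i q₀ q₁ h, by simp [h, Instr.IsQuery]⟩
  next i q h => exact .inr ⟨.right c i q h, by simp [h, Instr.IsQuery]⟩
  next i q h =>
    split_ifs with h0
    · exact .inl rfl
    · exact .inr ⟨.left c i q h _ (Nat.succ_pred_eq_of_ne_zero h0).symm,
        by simp [h, Instr.IsQuery]⟩
  next i b q h => exact .inr ⟨.write c i b q h, by simp [h, Instr.IsQuery]⟩
  all_goals exact .inl rfl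

/-- A step inspects only the vertex, the head positions and the cells under the heads, and alters no
cell except by writing a symbol fixed by the vertex. -/
lemma Machine.next_congr (M : Machine V) {c d : Config V} (hq : c.q = d.q) (hp : c.pos = d.pos)
    (ht : ∀ i, c.tape i (d.pos i) = d.tape i (d.pos i)) :
    (M.next c).q = (M.next d).q ∧ (M.next c).pos = (M.next d).pos ∧
      ∀ i j, c.tape i j = d.tape i j → (M.next c).tape i j = (M.next d).tape i j := by
  obtain ⟨q, w, p⟩ := c
  obtain ⟨q', w', p'⟩ := d
  dsimp only at hq hp ht
  subst hq hp
  unfold Machine.next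
  dsimp only
  cases M.instr q with
  | test i q₀ q₁ => simp [ht]
  | left i q => dsimp only; split_ifs <;> simp
  | write i b q =>
    refine ⟨rfl, rfl, fun k j hkj => ?_⟩
    rcases eq_or_ne k i.succ with rfl | hk
    · simp only [Function.update_self, Function.update_apply]
      split_ifs <;> first | rfl | exact hkj
    · simpa only [Function.update_of_ne hk] using hkj
  | _ => simp

/-! ### Convergence of configurations -/

/-- Convergence of configurations: vertex and head positions are eventually constant, and the
tapes converge pointwise. -/
structure ConfigTendsto {X : Type*} (c : X → Config V) (F : Filter X) (c₀ : Config V) : Prop where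
  q : ∀ᶠ x in F, (c x).q = c₀.q
  pos : ∀ᶠ x in F, (c x).pos = c₀.pos
  tape : ∀ i j, ∀ᶠ x in F, (c x).tape i j = c₀.tape i j

lemma ConfigTendsto.mono {X : Type*} {c : X → Config V} {F G : Filter X} {c₀ : Config V}
    (h : ConfigTendsto c F c₀) (hG : G ≤ F) : ConfigTendsto c G c₀ :=
  ⟨hG h.q, hG h.pos, fun i j => hG (h.tape i j)⟩

lemma ConfigTendsto.next {X : Type*} {c : X → Config V} {F : Filter X} {c₀ : Config V}
    (h : ConfigTendsto c F c₀) : ConfigTendsto (fun x => M.next (c x)) F (M.next c₀) := by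
  have key : ∀ᶠ x in F, (c x).q = c₀.q ∧ (c x).pos = c₀.pos ∧
      ∀ i, (c x).tape i (c₀.pos i) = c₀.tape i (c₀.pos i) :=
    h.q.and (h.pos.and (eventually_all.2 fun i => h.tape i _))
  refine ⟨?_, ?_, fun i j => ?_⟩
  · exact key.mono fun x hx => (M.next_congr hx.1 hx.2.1 hx.2.2).1
  · exact key.mono fun x hx => (M.next_congr hx.1 hx.2.1 hx.2.2).2.1
  · filter_upwards [key, h.tape i j] with x hx hij
    exact (M.next_congr hx.1 hx.2.1 hx.2.2).2.2 i j hij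

lemma ConfigTendsto.iterate_next {X : Type*} {c : X → Config V} {F : Filter X} {c₀ : Config V}
    (h : ConfigTendsto c F c₀) (t : ℕ) :
    ConfigTendsto (fun x => M.next^[t] (c x)) F (M.next^[t] c₀) := by
  induction t with
  | zero => exact h
  | succ t ih =>
    simp only [Function.iterate_succ_apply']
    exact ih.next

/-- The configuration in which the oracle's argument is computed. -/
def Config.spawn (q : V) (c : Config V) : Config V where
  q := q
  tape := Function.update c.tape 3 zeroSeq
  pos := Function.update c.pos 3 0

/-- The configuration after the oracle's answer `y`. -/
def Config.answer (q : V) (y : Seq) (c : Config V) : Config V where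
  q := q
  tape := Function.update c.tape 2 y
  pos := Function.update c.pos 2 0

lemma ConfigTendsto.replace_tape {X : Type*} {c : X → Config V} {F : Filter X} {c₀ : Config V}
    (h : ConfigTendsto c F c₀) (q : V) (k : Fin 4) (y : Seq) :
    ConfigTendsto (fun x => (⟨q, Function.update (c x).tape k y,
      Function.update (c x).pos k 0⟩ : Config V)) F
      ⟨q, Function.update c₀.tape k y, Function.update c₀.pos k 0⟩ := by
  refine ⟨.of_forall fun _ => rfl, h.pos.mono fun x hx => by simp [hx], fun i j => ?_⟩
  rcases eq_or_ne i k with rfl | hi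
  · simp
  · simpa only [Function.update_of_ne hi] using h.tape i j

/-! ### Outputs -/

/-- The `j`-th symbol of the output cannot change any more. -/
def Machine.Settled (M : Machine V) (c : Config V) (j : ℕ) : Prop :=
  M.instr c.q = .accept ∨ j < c.pos 3

/-- Every symbol of `w` is eventually settled on the output tape along the transitions `r`. -/
def Machine.Outputs (M : Machine V) (r : Config V → Config V → Prop) (c : Config V) (w : Seq) :
    Prop :=
  ∀ j, ∃ c', Relation.ReflTransGen r c c' ∧ M.Settled c' j ∧ c'.tape 3 j = w j

/-- For infinite output, take `m > j` so late that symbol `j` has stabilised: with the output head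
at `m` it is settled. `Outputs` treats both modes of output alike. -/
lemma Machine.Yields.outputs {r : Config V → Config V → Prop} {c : Config V} {w : Seq}
    (h : M.Yields (Relation.ReflTransGen r) c w) : M.Outputs r c w := by
  intro j
  rcases h with ⟨c', hc, ha, rfl⟩ | ⟨d, hd, hw⟩
  · exact ⟨c', hc, .inl ha, rfl⟩
  · have h1 : ∀ᶠ m in atTop, (d m).tape 3 j = w j :=
      ((continuous_apply j).tendsto w).comp hw |>.eventually
        (by rw [nhds_discrete]; exact rfl : ∀ᶠ b in 𝓝 (w j), b = w j)
    obtain ⟨m, hm, hm1, hm2⟩ :=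
      (h1.and ((eventually_ge_atTop (c.pos 3)).and (eventually_gt_atTop j))).exists
    obtain ⟨hr, hp⟩ := hd m hm1
    exact ⟨d m, hr, .inr (by rw [hp]; exact hm2), hm⟩

/-- Deterministic transitions which never change settled output. -/
structure Machine.Admissible (M : Machine V) (r : Config V → Config V → Prop) : Prop where
  rightUnique : Relator.RightUnique r
  settled : ∀ c c' j, r c c' → M.Settled c j → M.Settled c' j ∧ c'.tape 3 j = c.tape 3 j

namespace Machine.Admissible

variable {r : Config V → Config V → Prop} {c c' : Config V} {w : Seq} {j : ℕ}

lemma settled_of_reflTransGen (hr : M.Admissible r) (h : Relation.ReflTransGen r c c')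
    (hj : M.Settled c j) : M.Settled c' j ∧ c'.tape 3 j = c.tape 3 j := by
  induction h with
  | refl => exact ⟨hj, rfl⟩
  | tail _ hs ih =>
    have := hr.settled _ _ _ hs ih.1
    exact ⟨this.1, this.2.trans ih.2⟩

/-- By determinism `c'` lies before or after the configuration that settles symbol `j`; in the
latter case the symbol is still intact at `c'`. -/
lemma outputs_of_reflTransGen (hr : M.Admissible r) (h : Relation.ReflTransGen r c c')
    (hw : M.Outputs r c w) : M.Outputs r c' w := by
  intro j
  obtain ⟨d, hd, hj, hwj⟩ := hw j
  rcases Relation.ReflTransGen.total_of_right_unique hr.rightUnique h hd with h' | h'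
  · exact ⟨d, h', hj, hwj⟩
  · have := hr.settled_of_reflTransGen h' hj
    exact ⟨c', .refl, this.1, this.2.trans hwj⟩

lemma output_eq_of_settled (hr : M.Admissible r) (h : Relation.ReflTransGen r c c')
    (hw : M.Outputs r c w) (hj : M.Settled c' j) : w j = c'.tape 3 j := by
  obtain ⟨d, hd, -, hwj⟩ := hr.outputs_of_reflTransGen h hw j
  rw [← hwj, (hr.settled_of_reflTransGen hd hj).2]

lemma outputs_unique (hr : M.Admissible r) {w' : Seq} (hw : M.Outputs r c w)
    (hw' : M.Outputs r c w') : w = w' := by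
  funext j
  obtain ⟨d, hd, hj, hwj⟩ := hw j
  rw [← hwj, hr.output_eq_of_settled hd hw' hj]

end Machine.Admissible

/-- A computation which produces an output cannot get stuck except at an accepting vertex. -/
lemma Machine.Outputs.exists_step {r : Config V → Config V → Prop} {c : Config V} {w : Seq}
    (hw : M.Outputs r c w) (ha : M.instr c.q ≠ .accept) : ∃ c', r c c' := by
  -- The symbol under the output head is not yet settled at a non-accepting `c`.
  obtain ⟨d, hd, hj, -⟩ := hw (c.pos 3)
  rcases hd.cases_head with rfl | ⟨c', h, -⟩
  · rcases hj with hj | hj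
    · exact absurd hj ha
    · exact absurd hj (lt_irrefl _)
  · exact ⟨c', h⟩

/-- Moves act on the tapes `0`, `1`, `2` only, so the output head never goes back over what it has
written. -/
lemma Machine.admissible_step (M : Machine V) : M.Admissible M.Step where
  rightUnique _ _ _ h h' := h.next_eq.symm.trans h'.next_eq
  settled c c' j h hj := by
    cases h with
    | start q h => simp_all [Settled]
    | test i q₀ q₁ h => simp_all [Settled]
    | right i q h =>
      have h3 : (3 : Fin 4) ≠ i.castSucc := by fin_cases i <;> decide
      simp_all [Settled]
    | left i q h n hn =>
      have h3 : (3 : Fin 4) ≠ i.castSucc := by fin_cases i <;> decide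
      simp_all [Settled]
    | write i b q h =>
      have hj : j < c.pos 3 := by simpa [Settled, h] using hj
      rcases eq_or_ne 3 i.succ with h3 | h3
      · simp only [Settled, ← h3, Function.update_self, Function.update_of_ne hj.ne]
        exact ⟨.inr (hj.trans (Nat.lt_succ_self _)), trivial⟩
      · simp only [Settled, Function.update_of_ne h3]
        exact ⟨.inr hj, trivial⟩

lemma Machine.Step.not_isQuery {c c' : Config V} (h : M.Step c c') :
    ¬ (M.instr c.q).IsQuery := by
  rintro ⟨q₀, q₁, hq⟩
  cases h <;> simp_all

lemma Machine.oracleStep_one_iff {c c' : Config V} : M.OracleStep LPOOracle 1 c c' ↔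
    M.Step c c' ∨ ∃ q₀ q₁ x, M.instr c.q = .query q₀ q₁ ∧
      M.Yields (Relation.ReflTransGen M.Step) (c.spawn q₁) x ∧ c' = c.answer q₀ (LPO x) := by
  constructor
  · rintro (h | ⟨q₀, q₁, x, y, hq, hx, hy, hc⟩)
    · exact .inl h
    · obtain rfl : y = LPO x := hy
      exact .inr ⟨q₀, q₁, x, hq, hx, hc⟩
  · rintro (h | ⟨q₀, q₁, x, hq, hx, hc⟩)
    · exact .inl h
    · exact .inr ⟨q₀, q₁, x, LPO x, hq, hx, rfl, hc⟩

/-- The oracle's argument is unique because ordinary transitions are admissible, and an answer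
changes only tape `2`, never the output. -/
lemma Machine.admissible_oracleStep (M : Machine V) :
    M.Admissible (M.OracleStep LPOOracle 1) where
  rightUnique c d d' h h' := by
    rw [oracleStep_one_iff] at h h'
    rcases h with h | ⟨q₀, q₁, x, hq, hx, rfl⟩ <;> rcases h' with h' | ⟨q₀', q₁', x', hq', hx', rfl⟩
    · exact M.admissible_step.rightUnique h h'
    · exact absurd ⟨_, _, hq'⟩ h.not_isQuery
    · exact absurd ⟨_, _, hq⟩ h'.not_isQuery
    · obtain ⟨rfl, rfl⟩ : q₀ = q₀' ∧ q₁ = q₁' := by simpa [hq] using hq'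
      rw [M.admissible_step.outputs_unique hx.outputs hx'.outputs]
  settled c c' j h hj := by
    rw [oracleStep_one_iff] at h
    rcases h with h | ⟨q₀, q₁, x, hq, hx, rfl⟩
    · exact M.admissible_step.settled _ _ _ h hj
    · have hj : j < c.pos 3 := by simpa [Settled, hq] using hj
      exact ⟨.inr (by simpa [Config.answer] using hj), by simp [Config.answer]⟩

/-! ### Runs -/

lemma Machine.Run.trans {O : Seq → Set Seq} {d : ℕ} {c c' c'' : Config V} {k l : ℕ}
    (h : M.Run O d c k c') (h' : M.Run O d c' l c'') : M.Run O d c (k + l) c'' := by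
  induction h' with
  | refl => exact h
  | step _ hs hq ih => exact .step ih hs hq
  | call _ hs hq ih => exact .call ih hs hq

lemma Machine.run_iterate_next (M : Machine V) (c : Config V) (t : ℕ) :
    M.Run LPOOracle 1 c 0 (M.next^[t] c) := by
  induction t with
  | zero => exact .refl c
  | succ t ih =>
    rw [Function.iterate_succ_apply']
    rcases M.next_eq_self_or_step (M.next^[t] c) with h | ⟨h, hq⟩
    · rwa [h]
    · exact .step ih (.inl h) hq

lemma Machine.Run.reflTransGen {O : Seq → Set Seq} {d : ℕ} {c c' : Config V} {k : ℕ}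
    (h : M.Run O d c k c') : Relation.ReflTransGen (M.OracleStep O d) c c' := by
  induction h with
  | refl => exact .refl
  | step _ hs _ ih => exact ih.tail hs
  | call _ hs _ ih => exact ih.tail hs

lemma Machine.exists_iterate_next_of_step {c c' : Config V}
    (h : Relation.ReflTransGen M.Step c c') : ∃ t, M.next^[t] c = c' := by
  induction h with
  | refl => exact ⟨0, rfl⟩
  | tail _ hs ih =>
    obtain ⟨t, rfl⟩ := ih
    exact ⟨t + 1, by rw [Function.iterate_succ_apply', hs.next_eq]⟩

lemma Machine.exists_iterate_next_of_oracleStep {c c' : Config V}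
    (hn : ∀ t, ¬ (M.instr (M.next^[t] c).q).IsQuery)
    (h : Relation.ReflTransGen (M.OracleStep LPOOracle 1) c c') : ∃ t, M.next^[t] c = c' := by
  induction h with
  | refl => exact ⟨0, rfl⟩
  | tail _ hs ih =>
    obtain ⟨t, rfl⟩ := ih
    rcases oracleStep_one_iff.1 hs with hs | ⟨q₀, q₁, x, hq, -⟩
    · exact ⟨t + 1, by rw [Function.iterate_succ_apply', hs.next_eq]⟩
    · exact absurd ⟨_, _, hq⟩ (hn t)

lemma Machine.reflTransGen_step_iterate_next (M : Machine V) (c : Config V) (t : ℕ) :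
    Relation.ReflTransGen M.Step c (M.next^[t] c) := by
  induction t with
  | zero => exact .refl
  | succ t ih =>
    rw [Function.iterate_succ_apply']
    rcases M.next_eq_self_or_step (M.next^[t] c) with h | ⟨h, -⟩
    · rwa [h]
    · exact ih.tail h

/-! ### Continuity of outputs -/

/-- If the output of `c₀` is produced by ordinary transitions, then nearby configurations have
nearby outputs. -/
lemma Machine.Admissible.eventually_output_eq {X : Type*} {F : Filter X}
    {r : Config V → Config V → Prop} (hr : M.Admissible r)
    (hle : ∀ c t, Relation.ReflTransGen r c (M.next^[t] c))
    {c : X → Config V} {c₀ : Config V} {w : X → Seq} {w₀ : Seq}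
    (h : ConfigTendsto c F c₀) (hw : ∀ᶠ x in F, M.Outputs r (c x) (w x))
    (hw₀ : M.Outputs r c₀ w₀)
    (hn : ∀ c', Relation.ReflTransGen r c₀ c' → ∃ t, M.next^[t] c₀ = c') (j : ℕ) :
    ∀ᶠ x in F, w x j = w₀ j := by
  obtain ⟨c', hc', hj, hwj⟩ := hw₀ j
  obtain ⟨t, rfl⟩ := hn c' hc'
  -- The time `t` depends on `c₀` and `j` alone; nearby configurations have the same symbol `j`,
  -- settled, after `t` steps.
  have ht := h.iterate_next (M := M) t
  filter_upwards [ht.q, ht.pos, ht.tape 3 j, hw] with x hq hp htape hwx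
  rw [hr.output_eq_of_settled (hle (c x) t) hwx (by simpa only [Settled, hq, hp] using hj),
    htape, hwj]

/-! ### The main induction -/

lemma LPO_of_ne {w : Seq} (h : w ≠ zeroSeq) : LPO w = Function.update zeroSeq 0 true :=
  if_neg h

lemma LPO_zeroSeq : LPO zeroSeq = zeroSeq := if_pos rfl

variable {X : Type*} [TopologicalSpace X] {f : X → Seq}

lemma continuousWithinAt_of_forall_not_isQuery {c : X → Config V} {S : Set X} {x₀ : X}
    (hx₀ : x₀ ∈ S) (hc : ConfigTendsto c (𝓝[S] x₀) (c x₀))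
    (hf : ∀ᶠ x in 𝓝[S] x₀, M.Outputs (M.OracleStep LPOOracle 1) (c x) (f x))
    (hn : ∀ t, ¬ (M.instr (M.next^[t] (c x₀)).q).IsQuery) : ContinuousWithinAt f S x₀ := by
  refine tendsto_pi_nhds.2 fun j => ?_
  refine Tendsto.congr' (EventuallyEq.symm ?_) tendsto_const_nhds
  exact M.admissible_oracleStep.eventually_output_eq
    (fun c t => (M.run_iterate_next c t).reflTransGen) hc hf (hf.self_of_nhdsWithin hx₀)
    (fun c' => Machine.exists_iterate_next_of_oracleStep hn) j

/-- If all computations are about to ask the oracle, and `k` derivations suffice for the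
computations that have received any one fixed answer, then `k + k` derivations suffice. -/
lemma iterate_derivSet_inter_eq_empty_of_query {S U : Set X} (hS : IsClosed S) (hU : IsOpen U)
    {c : X → Config V} (hc : ∀ x ∈ S ∩ U, ConfigTendsto c (𝓝[S] x) (c x)) {q₀ q₁ : V}
    (hq : ∀ x ∈ S ∩ U, M.instr (c x).q = .query q₀ q₁)
    (hf : ∀ x ∈ S ∩ U, M.Outputs (M.OracleStep LPOOracle 1) (c x) (f x)) {k : ℕ}
    (ih : ∀ (y : Seq) (T W : Set X), T ⊆ S → W ⊆ U → IsClosed T → IsOpen W →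
      (∀ x ∈ T ∩ W, M.OracleStep LPOOracle 1 (c x) ((c x).answer q₀ y)) →
      (derivSet f)^[k] T ∩ W = ∅) :
    (derivSet f)^[k + k] S ∩ U = ∅ := by
  -- A computation with output is not stuck at the query, so the oracle's argument exists; off `S ∩
  -- U` the value is arbitrary.
  have hg : ∀ x, ∃ w, x ∈ S ∩ U → M.Yields (Relation.ReflTransGen M.Step) ((c x).spawn q₁) w := by
    intro x
    by_cases hx : x ∈ S ∩ U
    · obtain ⟨c', hc'⟩ := (hf x hx).exists_step (by simp [hq x hx])
      rcases Machine.oracleStep_one_iff.1 hc' with h | ⟨q₀', q₁', w, hq', hw, -⟩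
      · exact absurd ⟨_, _, hq x hx⟩ h.not_isQuery
      · obtain ⟨rfl, rfl⟩ : q₀ = q₀' ∧ q₁ = q₁' := by simpa [hq x hx] using hq'
        exact ⟨w, fun _ => hw⟩
    · exact ⟨zeroSeq, fun h => absurd h hx⟩
  choose g hg using hg
  have hstep : ∀ x ∈ S ∩ U, M.OracleStep LPOOracle 1 (c x) ((c x).answer q₀ (LPO (g x))) :=
    fun x hx => Machine.oracleStep_one_iff.2 (.inr ⟨q₀, q₁, g x, hq x hx, hg x hx, rfl⟩)
  -- `g` is controlled only along `S ∩ U`; this makes the condition `g ≠ 0^ℕ` open in `X`.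
  let W : Set X := {x | ∀ᶠ y in 𝓝 x, y ∈ S ∩ U → g y ≠ zeroSeq}
  have hW : IsOpen W := isOpen_setOfPred_eventually_nhds
  have hgW : ∀ x ∈ S ∩ U, g x ≠ zeroSeq → x ∈ W := by
    intro x hx hgx
    obtain ⟨j, hj⟩ := Function.ne_iff.1 hgx
    have hev : ∀ᶠ y in 𝓝[S] x, y ∈ S ∩ U :=
      inter_mem self_mem_nhdsWithin (mem_nhdsWithin_of_mem_nhds (hU.mem_nhds hx.2))
    have := M.admissible_step.eventually_output_eq M.reflTransGen_step_iterate_next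
      ((hc x hx).replace_tape q₁ 3 zeroSeq) (hev.mono fun y hy => (hg y hy).outputs)
      (hg x hx).outputs (fun c' => Machine.exists_iterate_next_of_step) j
    filter_upwards [eventually_nhdsWithin_iff.1 this] with y hy hyS hgy
    exact hj (by rw [← hy hyS.1, hgy])
  have h1 : (derivSet f)^[k] S ∩ (U ∩ W) = ∅ := by
    refine ih (Function.update zeroSeq 0 true) S (U ∩ W) subset_rfl inter_subset_left hS
      (hU.inter hW) fun x hx => ?_
    have hxU : x ∈ S ∩ U := ⟨hx.1, hx.2.1⟩
    have hgx : g x ≠ zeroSeq := (hx.2.2 : ∀ᶠ y in 𝓝 x, _).self_of_nhds hxU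
    simpa only [LPO_of_ne hgx] using hstep x hxU
  -- The first `k` derivations leave only points with `g x = 0^ℕ`; the other `k` start from that
  -- closed set.
  rw [Function.iterate_add_apply]
  refine ih zeroSeq _ U (iterate_derivSet_subset hS k) subset_rfl
    (isClosed_iterate_derivSet hS k) hU fun x hx => ?_
  have hxU : x ∈ S ∩ U := ⟨iterate_derivSet_subset hS k hx.1, hx.2⟩
  have hgx : g x = zeroSeq := by
    by_contra hne
    exact (h1 ▸ (⟨hx.1, hx.2, hgW x hxU hne⟩ : x ∈ _ ∩ (U ∩ W)) : x ∈ (∅ : Set X))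
  simpa only [hgx, LPO_zeroSeq] using hstep x hxU

/-- At the points whose computations ask no question `f` is continuous, so it suffices to treat
neighbourhoods of the other points. -/
lemma iterate_derivSet_inter_eq_empty_of_local {S U : Set X} (hS : IsClosed S) (hU : IsOpen U)
    {c : X → Config V} (hc : ∀ x ∈ S ∩ U, ConfigTendsto c (𝓝[S] x) (c x))
    (hf : ∀ x ∈ S ∩ U, M.Outputs (M.OracleStep LPOOracle 1) (c x) (f x)) {k : ℕ} (hk : k ≠ 0)
    (hloc : ∀ x ∈ S ∩ U, ∀ t, (M.instr (M.next^[t] (c x)).q).IsQuery →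
      ∃ W, IsOpen W ∧ x ∈ W ∧ (derivSet f)^[k] S ∩ W = ∅) :
    (derivSet f)^[k] S ∩ U = ∅ := by
  obtain ⟨m, rfl⟩ := Nat.exists_eq_succ_of_ne_zero hk
  simp only [Nat.succ_eq_add_one, Function.iterate_succ_apply'] at hloc ⊢
  rw [← disjoint_iff_inter_eq_empty]
  -- As `U` is open, the closure in the last derivation can be dropped.
  refine Disjoint.closure_left (disjoint_left.2 fun x hx hxU => ?_) hU
  have hxS := iterate_derivSet_subset hS m hx.1
  by_cases hq : ∀ t, ¬ (M.instr (M.next^[t] (c x)).q).IsQuery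
  · have hev : ∀ᶠ y in 𝓝[S] x, y ∈ S ∩ U :=
      inter_mem self_mem_nhdsWithin (mem_nhdsWithin_of_mem_nhds (hU.mem_nhds hxU))
    exact hx.2 ((continuousWithinAt_of_forall_not_isQuery hxS (hc x ⟨hxS, hxU⟩)
      (hev.mono hf) hq).mono (iterate_derivSet_subset hS m))
  · push Not at hq
    obtain ⟨t, ht⟩ := hq
    obtain ⟨W, -, hxW, hW⟩ := hloc x ⟨hxS, hxU⟩ t ht
    exact (hW ▸ (⟨subset_closure hx, hxW⟩ : x ∈ derivSet f _ ∩ W) : x ∈ (∅ : Set X))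

/-- Arbitrary `c`, `S` and `U` let the induction restart after an answer, on a derived set and on a
smaller neighbourhood. -/
theorem iterate_derivSet_inter_eq_empty (n : ℕ) {S U : Set X} (hS : IsClosed S) (hU : IsOpen U)
    {c : X → Config V} (hc : ∀ x ∈ S ∩ U, ConfigTendsto c (𝓝[S] x) (c x))
    (hf : ∀ x ∈ S ∩ U, M.Outputs (M.OracleStep LPOOracle 1) (c x) (f x))
    (hn : ∀ x ∈ S ∩ U, ∀ k c', M.Run LPOOracle 1 (c x) k c' → k ≤ n) :
    (derivSet f)^[2 ^ n] S ∩ U = ∅ := by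
  have hf' : ∀ x ∈ S ∩ U, ∀ t,
      M.Outputs (M.OracleStep LPOOracle 1) (M.next^[t] (c x)) (f x) := fun x hx t =>
    M.admissible_oracleStep.outputs_of_reflTransGen (M.run_iterate_next _ t).reflTransGen (hf x hx)
  induction n generalizing S U c with
  | zero =>
    refine iterate_derivSet_inter_eq_empty_of_local hS hU hc hf (by simp) fun x hx t ht => ?_
    obtain ⟨q₀, q₁, hq⟩ := ht
    obtain ⟨c', hc'⟩ := (hf' x hx t).exists_step (by simp [hq])
    exact absurd (hn x hx _ _ (.call (M.run_iterate_next _ t) hc' ⟨q₀, q₁, hq⟩)) (by simp)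
  | succ n ih =>
    refine iterate_derivSet_inter_eq_empty_of_local hS hU hc hf (by simp) fun x hx t ht => ?_
    obtain ⟨q₀, q₁, hq⟩ := ht
    obtain ⟨W, hW, hxW, hWq⟩ := mem_nhdsWithin.1 ((hc x hx).iterate_next (M := M) t).q
    refine ⟨U ∩ W, hU.inter hW, ⟨hx.2, hxW⟩, ?_⟩
    have hsub : S ∩ (U ∩ W) ⊆ S ∩ U := inter_subset_inter_right _ inter_subset_left
    have hquery : ∀ y ∈ S ∩ (U ∩ W), M.instr (M.next^[t] (c y)).q = .query q₀ q₁ := by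
      intro y hy
      have : (M.next^[t] (c y)).q = (M.next^[t] (c x)).q := hWq ⟨hy.2.2, hy.1⟩
      rw [this, hq]
    rw [pow_succ, mul_two]
    refine iterate_derivSet_inter_eq_empty_of_query hS (hU.inter hW)
      (fun y hy => (hc y (hsub hy)).iterate_next (M := M) t) hquery
      (fun y hy => hf' y (hsub hy) t) fun a T Z hTS hZU hT hZ hstep => ?_
    have hTZ : T ∩ Z ⊆ S ∩ (U ∩ W) := inter_subset_inter hTS hZU
    have hout : ∀ y ∈ T ∩ Z, M.Outputs (M.OracleStep LPOOracle 1)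
        ((M.next^[t] (c y)).answer q₀ a) (f y) := fun y hy =>
      M.admissible_oracleStep.outputs_of_reflTransGen (.single (hstep y hy))
        (hf' y (hsub (hTZ hy)) t)
    refine ih hT hZ (c := fun y => (M.next^[t] (c y)).answer q₀ a) (fun y hy => ?_) hout
      (fun y hy k c' hrun => ?_) fun y hy s =>
        M.admissible_oracleStep.outputs_of_reflTransGen (M.run_iterate_next _ s).reflTransGen
          (hout y hy)
    · exact (((hc y (hsub (hTZ hy))).mono (nhdsWithin_mono _ hTS)).iterate_next t).replace_tape
        q₀ 2 a
    -- The query just answered uses up one of the `n + 1` calls.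
    · have := hn y (hsub (hTZ hy)) _ _ (((M.run_iterate_next (c y) t).call (hstep y hy)
        ⟨q₀, q₁, hquery y (hTZ hy)⟩).trans hrun)
      omega

lemma configTendsto_initConfig (M : Machine V) {D : Set Seq} (x : D) :
    ConfigTendsto (fun y : D => M.initConfig y) (𝓝 x) (M.initConfig x) := by
  refine ⟨.of_forall fun _ => rfl, .of_forall fun _ => rfl, fun i j => ?_⟩
  rcases eq_or_ne i 0 with rfl | hi
  · have : Tendsto (fun y : D => (y : Seq) j) (𝓝 x) (𝓝 ((x : Seq) j)) :=
      ((continuous_apply j).comp continuous_subtype_val).tendsto x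
    rw [nhds_discrete Bool, tendsto_pure] at this
    simpa [Machine.initConfig] using this
  · simp [Machine.initConfig, hi]

end OracleTypeTwo

theorem theorem24 {V : Type*} (M : OracleTypeTwo.Machine V) (n : ℕ)
    (D : Set OracleTypeTwo.Seq) (f : D → OracleTypeTwo.Seq)
    (hf : M.ComputesWithCalls OracleTypeTwo.LPOOracle n f) :
    OracleTypeTwo.Lev f ≤ (((2 ^ n : ℕ) : Ordinal.{0}) : WithTop Ordinal.{0}) := by
  apply OracleTypeTwo.Lev_le_of_levelSet_eq_empty
  rw [OracleTypeTwo.levelSet_natCast, ← inter_univ ((OracleTypeTwo.derivSet f)^[2 ^ n] univ)]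
  refine OracleTypeTwo.iterate_derivSet_inter_eq_empty n (M := M) (c := fun x : D => M.initConfig x)
    isClosed_univ isOpen_univ (fun x _ => ?_) (fun x _ => ?_) fun x _ => (hf x).2
  · rw [nhdsWithin_univ]
    exact OracleTypeTwo.configTendsto_initConfig M x
  · have : f x ∈ M.multiFun OracleTypeTwo.LPOOracle 1 x := by rw [(hf x).1]; rfl
    exact OracleTypeTwo.Machine.Yields.outputs this
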